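/- A binary tree here is a complete (plane) binary tree: a rooted tree in which every internal node has a left and a right child. Its size is its number of internal nodes, so a binary tree of size $n$ has $n+1$ leaves; these are indexed $0,1,\dots,n$ from left to right. The depth of a leaf is the number of edges on the path from the root to it. Theorem. For all fixed integers $r\ge 0$ and $d\ge 1$, the probability that the $r$th leaf of a uniformly random binary tree of size $n$ has depth $d$ converges to a limit $p_{r,d}$ as $n\to\infty$. These limits satisfy $$\sum_{r\ge 0}\sum_{d\ge 1} p_{r,d}\,x^r y^d=\frac{y}{\bigl(2-2y+y\sqrt{1-x}\bigr)^2}$$ as an identity of formal power series in $x$ and $y$ with real coefficients, where $\sqrt{1-x}$ is the formal power series with constant term $1$ whose square is $1-x$. -/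

import Mathlib

open Filter Topology

noncomputable section

/-- The depths of the leaves of a complete binary tree, listed from left to right. The constructor
`nil` is a leaf and the constructor `node` is an internal node, so that `BinaryTree Unit` is the
type of complete (plane) binary trees, and `numNodes` is the number of internal nodes. -/
def leafDepths : BinaryTree Unit → List ℕ
  | .nil => [0]
  | .node _ a b => (leafDepths a ++ leafDepths b).map (fun k => k + 1)

/-- The leaves are all listed. -/
theorem length_leafDepths (t : BinaryTree Unit) : (leafDepths t).length = t.numNodes + 1 := by
  induction t with
  | nil => simp [leafDepths]
  | node v a b iha ihb => simp [leafDepths, iha, ihb]; omega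

/-- The probability that the `r`th leaf (counted from `0`, from left to right) of a uniformly random
binary tree with `n` internal nodes exists and has depth `d`. -/
def leafDepthProb (n r d : ℕ) : ℝ :=
  (((BinaryTree.treesOfNumNodesEq n).filter (fun t => (leafDepths t)[r]? = some d)).card : ℝ) /
    ((BinaryTree.treesOfNumNodesEq n).card : ℝ)

/-- The formal power series `√(1 - x)` in one variable, that is, `(1 + X) ^ (1 / 2)` at `X = -x`. -/
def sqrtOneSub : PowerSeries ℝ :=
  PowerSeries.rescale (-1 : ℝ) (PowerSeries.binomialSeries ℝ (1 / 2 : ℝ))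

/-- The formal power series `√(1 - x)` in the two variables `x = X 0` and `y = X 1`. -/
def sqrtOneSubX : MvPowerSeries (Fin 2) ℝ :=
  PowerSeries.subst (MvPowerSeries.X 0 : MvPowerSeries (Fin 2) ℝ) sqrtOneSub

theorem sqrtOneSub_sq : sqrtOneSub ^ 2 = 1 - PowerSeries.X := by
  have h : (PowerSeries.binomialSeries ℝ (1 / 2 : ℝ)) ^ 2 = 1 + PowerSeries.X := by
    rw [sq, ← PowerSeries.binomialSeries_add]
    have := PowerSeries.binomialSeries_nat (R := ℝ) (A := ℝ) 1
    norm_num at this ⊢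
    exact this
  rw [sqrtOneSub, ← map_pow, h, map_add, map_one, PowerSeries.rescale_X]
  simp [sub_eq_add_neg]

/-- `sqrtOneSubX` is a square root of `1 - x`. -/
theorem sqrtOneSubX_sq : sqrtOneSubX ^ 2 = 1 - MvPowerSeries.X 0 := by
  have hX : PowerSeries.HasSubst (MvPowerSeries.X 0 : MvPowerSeries (Fin 2) ℝ) :=
    PowerSeries.HasSubst.X 0
  rw [sqrtOneSubX, ← PowerSeries.subst_pow hX, sqrtOneSub_sq, ← PowerSeries.coe_substAlgHom hX,
    map_sub, map_one, PowerSeries.substAlgHom_X]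

/-- `sqrtOneSubX` is the square root of `1 - x` with constant term `1`. -/
theorem constantCoeff_sqrtOneSubX : MvPowerSeries.constantCoeff sqrtOneSubX = 1 := by
  have hX : PowerSeries.HasSubst (MvPowerSeries.X 0 : MvPowerSeries (Fin 2) ℝ) :=
    PowerSeries.HasSubst.X 0
  rw [sqrtOneSubX, PowerSeries.constantCoeff_subst hX, finsum_eq_single _ 0]
  · simp [sqrtOneSub]
  · intro k hk
    simp [hk]

/-- The formal power series `∑_{r ≥ 0} ∑_{d ≥ 1} p r d * x ^ r * y ^ d` in the two variables
`x = X 0` and `y = X 1`. -/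
def depthSeries (p : ℕ → ℕ → ℝ) : MvPowerSeries (Fin 2) ℝ :=
  fun e => if 1 ≤ e 1 then p (e 0) (e 1) else 0

end

/-!
Fix `r` and `d`, and let `T r d` be the generating function, by size, of the trees whose `r`th leaf
has depth `d`; let `C = 1 + z C²` be the Catalan series. Splitting a tree at its root, the marked
leaf lies in the left subtree, or the left subtree of size `k - 1` comes before it, so
`T r (d+1) = z T r d C + ∑_{k + l = r} [z^k](z C) z^k T l d` (`leafSeries_succ`).

Say that `f` has *Catalan ratio* `L` if `[zⁿ] f / [zⁿ] C → L`. Since `catalan (n+1) / catalan n → 4`,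
multiplication by `z` divides the ratio by `4`; and since `z C^(m+1) = C^m - C^(m-1)`, the ratios
of the powers of `C` satisfy a linear recurrence, from which `C^m` has ratio `m 2^(m-1)`. No singularity analysis is needed. Feeding this into the recursion for `T r d * C^m`,
by induction on `d` for all `m` at once, shows that `T r d * C^m` has the ratio
`[x^r] 2^m (d/4 q^(d-1) + m/2 q^d)`, where `q = 1/2 + v` and `v = x/4 C(x/4)`
(`hasCatalanRatio_leafSeries_mul_pow`). The equation of `C` becomes `(1 - 2v)² = 1 - x`, so
`q = 1 - √(1-x)/2`. With `m = 0` the limits are `p r d = [x^r] d/4 q^(d-1)`, and summing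
`∑ d y^d q^(d-1) = y / (1 - y q)²` over `d` gives the closed form.
-/

open PowerSeries (catalanSeries)

/-! ### Generating functions of trees with a leaf of given index and depth -/

/-- The number of binary trees of size `n` whose `r`th leaf exists and has depth `d`. -/
def leafCount (n r d : ℕ) : ℕ :=
  ((BinaryTree.treesOfNumNodesEq n).filter (fun t => (leafDepths t)[r]? = some d)).card

/-- The generating function, by size, of the binary trees whose `r`th leaf has depth `d`. -/
def leafSeries (r d : ℕ) : PowerSeries ℝ :=
  PowerSeries.mk fun n => (leafCount n r d : ℝ)

/-- The generating function of the Catalan numbers, with real coefficients. -/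
noncomputable def catalanSeriesReal : PowerSeries ℝ :=
  PowerSeries.map (Nat.castRingHom ℝ) catalanSeries

theorem coeff_catalanSeriesReal (n : ℕ) :
    PowerSeries.coeff n catalanSeriesReal = (catalan n : ℝ) := by
  simp [catalanSeriesReal]

theorem catalanSeriesReal_eq :
    catalanSeriesReal = 1 + PowerSeries.X * catalanSeriesReal ^ 2 := by
  have h := congrArg (PowerSeries.map (Nat.castRingHom ℝ))
    PowerSeries.catalanSeries_sq_mul_X_add_one
  simp only [map_add, map_mul, map_pow, map_one, PowerSeries.map_X] at h
  change catalanSeriesReal ^ 2 * PowerSeries.X + 1 = catalanSeriesReal at h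
  rw [mul_comm, add_comm] at h
  exact h.symm

/-- The `r`th leaf of a tree is a leaf of the left subtree if there are enough of those, and
otherwise a leaf of the right subtree, with its index shifted. -/
theorem leafDepths_node_getElem? (a b : BinaryTree Unit) (r d : ℕ) :
    (leafDepths (.node () a b))[r]? = some (d + 1) ↔
      (leafDepths a)[r]? = some d ∨
        (a.numNodes < r ∧ (leafDepths b)[r - (a.numNodes + 1)]? = some d) := by
  have hl := length_leafDepths a
  rw [leafDepths, List.getElem?_map, List.getElem?_append]
  by_cases h : r < (leafDepths a).length
  · have h' : ¬ a.numNodes < r := by omega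
    simp [h, h']
  · have h' : a.numNodes < r := by omega
    simp [h', hl]

/-- The trees with a given size of the left and of the right subtree, whose `r`th leaf has depth
`d + 1`. -/
theorem card_filter_pairwiseNode (i j r d : ℕ) :
    ((BinaryTree.pairwiseNode (BinaryTree.treesOfNumNodesEq i)
        (BinaryTree.treesOfNumNodesEq j)).filter
          (fun t => (leafDepths t)[r]? = some (d + 1))).card =
      leafCount i r d * catalan j +
        if i < r then catalan i * leafCount j (r - (i + 1)) d else 0 := by
  classical
  rw [BinaryTree.pairwiseNode, Finset.filter_map, Finset.card_map]
  have h : ∀ x ∈ BinaryTree.treesOfNumNodesEq i ×ˢ BinaryTree.treesOfNumNodesEq j,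
      (((fun t => (leafDepths t)[r]? = some (d + 1)) ∘
        (⟨fun x : BinaryTree Unit × BinaryTree Unit => BinaryTree.node () x.1 x.2,
          fun ⟨x₁, x₂⟩ ⟨y₁, y₂⟩ => fun h => by simpa using h⟩ :
            BinaryTree Unit × BinaryTree Unit ↪ BinaryTree Unit)) x ↔
        ((leafDepths x.1)[r]? = some d ∧ True) ∨
          (True ∧ (i < r ∧ (leafDepths x.2)[r - (i + 1)]? = some d))) := by
    rintro ⟨a, b⟩ hab
    simp only [Finset.mem_product, BinaryTree.mem_treesOfNumNodesEq] at hab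
    simp only [true_and, and_true]
    change (leafDepths (BinaryTree.node () a b))[r]? = some (d + 1) ↔ _
    rw [leafDepths_node_getElem?, hab.1]
  rw [Finset.filter_congr h, Finset.filter_or, Finset.card_union_of_disjoint,
    Finset.filter_product (fun t => (leafDepths t)[r]? = some d) (fun _ => True),
    Finset.filter_product (fun _ => True) (fun t => i < r ∧ (leafDepths t)[r - (i + 1)]? = some d),
    Finset.card_product, Finset.card_product]
  · simp only [Finset.filter_true, BinaryTree.treesOfNumNodesEq_card_eq_catalan]
    congr 1
    by_cases hi : i < r <;> simp [hi, leafCount]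
  · rw [Finset.disjoint_filter]
    rintro ⟨a, b⟩ hab h1 ⟨-, h2, -⟩
    simp only [Finset.mem_product, BinaryTree.mem_treesOfNumNodesEq] at hab
    obtain ⟨h3, -⟩ := List.getElem?_eq_some_iff.1 h1.1
    rw [length_leafDepths, hab.1] at h3
    omega

theorem leafCount_succ (n r d : ℕ) :
    leafCount (n + 1) r (d + 1) = ∑ ij ∈ Finset.HasAntidiagonal.antidiagonal n,
      (leafCount ij.1 r d * catalan ij.2 +
        if ij.1 < r then catalan ij.1 * leafCount ij.2 (r - (ij.1 + 1)) d else 0) := by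
  classical
  rw [leafCount, BinaryTree.treesOfNumNodesEq_succ, Finset.filter_biUnion, Finset.card_biUnion]
  · exact Finset.sum_congr rfl fun ij _ => card_filter_pairwiseNode _ _ _ _
  · rintro ⟨i, j⟩ - ⟨i', j'⟩ - hne
    rw [Function.onFun, Finset.disjoint_left]
    intro t ht ht'
    simp only [Finset.mem_filter, BinaryTree.pairwiseNode, Finset.mem_map, Finset.mem_product,
      BinaryTree.mem_treesOfNumNodesEq, Prod.exists] at ht ht'
    obtain ⟨⟨a, b, ⟨rfl, rfl⟩, rfl⟩, -⟩ := ht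
    obtain ⟨⟨a', b', ⟨rfl, rfl⟩, he⟩, -⟩ := ht'
    have he := (BinaryTree.node.injEq _ _ _ _ _ _).mp he
    obtain ⟨-, rfl, rfl⟩ := he
    exact hne rfl

theorem leafCount_zero_succ (r d : ℕ) : leafCount 0 r (d + 1) = 0 := by
  rcases r with _ | r <;> simp [leafCount, leafDepths, Finset.filter_singleton]

/-- Only the tree without internal nodes has a leaf of depth `0`. -/
theorem leafSeries_zero (r : ℕ) : leafSeries r 0 = if r = 0 then 1 else 0 := by
  ext n
  rcases n with _ | n
  · rcases r with _ | r <;>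
      simp [leafSeries, leafCount, leafDepths, Finset.filter_singleton]
  · have h : leafCount (n + 1) r 0 = 0 := by
      rw [leafCount, Finset.card_eq_zero, Finset.filter_eq_empty_iff]
      intro t ht
      cases t with
      | nil => simp at ht
      | node u a b => simp [leafDepths, List.getElem?_map, -List.map_append]
    rw [leafSeries, PowerSeries.coeff_mk, h]
    split_ifs <;> simp [PowerSeries.coeff_one]

/-- The decomposition of a tree at its root. The term of index `(k, l)` counts the trees whose left
subtree has `k` leaves, all of them before the marked leaf; the factor vanishes for `k = 0`. -/
theorem leafSeries_succ (r d : ℕ) :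
    leafSeries r (d + 1) = PowerSeries.X * (leafSeries r d * catalanSeriesReal) +
      ∑ kl ∈ Finset.HasAntidiagonal.antidiagonal r,
        PowerSeries.C (PowerSeries.coeff kl.1 (PowerSeries.X * catalanSeriesReal)) *
          (PowerSeries.X ^ kl.1 * leafSeries kl.2 d) := by
  ext n
  simp only [map_add, map_sum, PowerSeries.coeff_C_mul]
  rcases n with _ | n
  · rw [leafSeries, PowerSeries.coeff_mk, leafCount_zero_succ, Finset.sum_eq_zero]
    · simp
    · rintro ⟨k, l⟩ -
      rcases k with _ | k <;> simp [pow_succ]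
  · rw [leafSeries, PowerSeries.coeff_mk, leafCount_succ, Finset.sum_add_distrib, Nat.cast_add,
      PowerSeries.coeff_succ_X_mul, PowerSeries.coeff_mul]
    congr 1
    · push_cast
      exact Finset.sum_congr rfl fun ij _ => by
        rw [leafSeries, PowerSeries.coeff_mk, coeff_catalanSeriesReal]
    · -- With `k = i + 1`, both sides are sums over the `i` such that `i < r` and `i ≤ n`.
      rw [Finset.Nat.sum_antidiagonal_eq_sum_range_succ_mk,
        Finset.Nat.sum_antidiagonal_eq_sum_range_succ_mk, Finset.sum_range_succ' _ r]
      simp only [PowerSeries.coeff_succ_X_mul, coeff_catalanSeriesReal,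
        PowerSeries.coeff_zero_X_mul, zero_mul, add_zero, PowerSeries.coeff_X_pow_mul']
      have h1 : ∑ i ∈ Finset.range n.succ,
          (if i < r then catalan i * leafCount (n - i) (r - (i + 1)) d else 0) =
          ∑ i ∈ (Finset.range (n + 1)).filter (· < r),
            catalan i * leafCount (n - i) (r - (i + 1)) d := by
        rw [Finset.sum_filter]
      have h2 : ∑ i ∈ Finset.range r, (catalan i : ℝ) * (if i + 1 ≤ n + 1 then
          PowerSeries.coeff (n + 1 - (i + 1)) (leafSeries (r - (i + 1)) d) else 0) =
          ∑ i ∈ (Finset.range r).filter (fun i => i + 1 ≤ n + 1),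
            (catalan i : ℝ) * (leafCount (n - i) (r - (i + 1)) d : ℝ) := by
        rw [Finset.sum_filter]
        refine Finset.sum_congr rfl fun i _ => ?_
        split_ifs
        · rw [leafSeries, PowerSeries.coeff_mk, Nat.add_sub_add_right]
        · simp
      rw [h1, h2]
      push_cast
      refine Finset.sum_congr ?_ fun _ _ => rfl
      ext i
      simp only [Finset.mem_filter, Finset.mem_range]
      omega

/-! ### Coefficients compared with the Catalan numbers -/

/-- The coefficients of `f`, divided by the Catalan numbers, tend to `L`. -/
def HasCatalanRatio (f : PowerSeries ℝ) (L : ℝ) : Prop :=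
  Tendsto (fun n => PowerSeries.coeff n f / (catalan n : ℝ)) atTop (𝓝 L)

theorem catalan_pos (n : ℕ) : 0 < catalan n := by
  have h := succ_mul_catalan_eq_centralBinom n
  have := Nat.centralBinom_pos n
  rw [← h] at this
  exact Nat.pos_of_mul_pos_left this

theorem catalan_succ_div_catalan (n : ℕ) :
    (catalan (n + 1) : ℝ) / catalan n = (4 * n + 2) / (n + 2) := by
  have h0 : (catalan n : ℝ) ≠ 0 := by exact_mod_cast (catalan_pos n).ne'
  have h1 := succ_mul_catalan_eq_centralBinom n
  have h2 := succ_mul_catalan_eq_centralBinom (n + 1)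
  have h3 := Nat.succ_mul_centralBinom_succ n
  rw [← h1, ← h2] at h3
  have h4 : ((n : ℝ) + 1) * ((n + 1 + 1) * catalan (n + 1)) =
      2 * (2 * n + 1) * ((n + 1) * catalan n) := by exact_mod_cast h3
  have h5 : (n : ℝ) + 1 ≠ 0 := by positivity
  have h6 : (n : ℝ) + 2 ≠ 0 := by positivity
  rw [div_eq_div_iff h0 h6]
  apply mul_left_cancel₀ h5
  linear_combination h4

theorem tendsto_catalan_succ_div :
    Tendsto (fun n => (catalan (n + 1) : ℝ) / catalan n) atTop (𝓝 4) := by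
  have h : Tendsto (fun n : ℕ => (4 : ℝ) - 6 / ((n : ℝ) + 2)) atTop (𝓝 (4 - 0)) := by
    refine tendsto_const_nhds.sub (tendsto_const_nhds.div_atTop ?_)
    exact tendsto_atTop_add_const_right _ _ tendsto_natCast_atTop_atTop
  rw [sub_zero] at h
  refine h.congr fun n => ?_
  have h6 : (n : ℝ) + 2 ≠ 0 := by positivity
  rw [catalan_succ_div_catalan]
  field_simp
  ring

namespace HasCatalanRatio

variable {f g : PowerSeries ℝ} {L M : ℝ}

theorem add (hf : HasCatalanRatio f L) (hg : HasCatalanRatio g M) :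
    HasCatalanRatio (f + g) (L + M) :=
  (Tendsto.add hf hg).congr fun n => by rw [map_add, add_div]

theorem sub (hf : HasCatalanRatio f L) (hg : HasCatalanRatio g M) :
    HasCatalanRatio (f - g) (L - M) :=
  (Tendsto.sub hf hg).congr fun n => by rw [map_sub, sub_div]

theorem C_mul (c : ℝ) (hf : HasCatalanRatio f L) :
    HasCatalanRatio (PowerSeries.C c * f) (c * L) :=
  (Tendsto.const_mul c hf).congr fun n => by rw [PowerSeries.coeff_C_mul, mul_div_assoc]

theorem zero : HasCatalanRatio 0 0 :=
  tendsto_const_nhds.congr fun n => by simp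

theorem sum {ι : Type*} {s : Finset ι} {F : ι → PowerSeries ℝ} {l : ι → ℝ}
    (h : ∀ i ∈ s, HasCatalanRatio (F i) (l i)) :
    HasCatalanRatio (∑ i ∈ s, F i) (∑ i ∈ s, l i) :=
  (tendsto_finsetSum s h).congr fun n => by rw [map_sum, Finset.sum_div]

theorem X_mul (hf : HasCatalanRatio f L) : HasCatalanRatio (PowerSeries.X * f) (L / 4) := by
  rw [HasCatalanRatio, ← tendsto_add_atTop_iff_nat 1]
  refine (Tendsto.div hf tendsto_catalan_succ_div four_ne_zero).congr fun n => ?_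
  have h0 : (catalan n : ℝ) ≠ 0 := by exact_mod_cast (catalan_pos n).ne'
  rw [PowerSeries.coeff_succ_X_mul]
  simp only [Pi.div_apply]
  field_simp

theorem of_X_mul (hf : HasCatalanRatio (PowerSeries.X * f) L) : HasCatalanRatio f (4 * L) := by
  rw [HasCatalanRatio, ← tendsto_add_atTop_iff_nat 1] at hf
  refine (Tendsto.mul tendsto_catalan_succ_div hf).congr fun n => ?_
  have h0 : (catalan (n + 1) : ℝ) ≠ 0 := by exact_mod_cast (catalan_pos _).ne'
  rw [PowerSeries.coeff_succ_X_mul]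
  field_simp

theorem X_pow_mul (hf : HasCatalanRatio f L) (k : ℕ) :
    HasCatalanRatio (PowerSeries.X ^ k * f) ((1 / 4) ^ k * L) := by
  induction k with
  | zero => simpa using hf
  | succ k ih =>
    convert ih.X_mul using 1 <;> ring

theorem one : HasCatalanRatio 1 0 := by
  refine tendsto_const_nhds.congr' ?_
  filter_upwards [eventually_ge_atTop 1] with n hn
  rw [PowerSeries.coeff_one, if_neg (by omega), zero_div]

theorem catalanSeriesReal : HasCatalanRatio catalanSeriesReal 1 :=
  tendsto_const_nhds.congr fun n => by
    have h0 : (catalan n : ℝ) ≠ 0 := by exact_mod_cast (catalan_pos n).ne'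
    rw [coeff_catalanSeriesReal, div_self h0]

end HasCatalanRatio

/-- The ratio of `C ^ m` is the derivative of `c ↦ c ^ m` at `c = 2`, the value of `C` at its
singularity `1 / 4`. -/
theorem hasCatalanRatio_catalanSeriesReal_pow (m : ℕ) :
    HasCatalanRatio (catalanSeriesReal ^ m) (m / 2 * 2 ^ m) := by
  induction m using Nat.twoStepInduction with
  | zero => simpa using HasCatalanRatio.one
  | one => simpa using HasCatalanRatio.catalanSeriesReal
  | more m h0 h1 =>
    have h : PowerSeries.X * catalanSeriesReal ^ (m + 2) =
        catalanSeriesReal ^ (m + 1) - catalanSeriesReal ^ m := by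
      linear_combination (-catalanSeriesReal ^ m) * catalanSeriesReal_eq
    have h2 := h1.sub h0
    rw [← h] at h2
    convert h2.of_X_mul using 1
    push_cast
    ring

/-! ### The limits -/

/-- The series `v = x/4 * C(x/4)`, so that `1 - 2 v = √(1 - x)`. -/
noncomputable def scaledCatalan : PowerSeries ℝ :=
  PowerSeries.rescale (1 / 4 : ℝ) (PowerSeries.X * catalanSeriesReal)

theorem scaledCatalan_eq :
    scaledCatalan = PowerSeries.C (1 / 4) * PowerSeries.X + scaledCatalan ^ 2 := by
  have h : PowerSeries.X * catalanSeriesReal =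
      PowerSeries.X + (PowerSeries.X * catalanSeriesReal) ^ 2 := by
    linear_combination PowerSeries.X * catalanSeriesReal_eq
  conv_lhs => rw [scaledCatalan, h, map_add, map_pow, PowerSeries.rescale_X]
  rfl

theorem constantCoeff_scaledCatalan : PowerSeries.constantCoeff scaledCatalan = 0 := by
  rw [← PowerSeries.coeff_zero_eq_constantCoeff_apply, scaledCatalan, PowerSeries.coeff_rescale]
  simp

theorem constantCoeff_sqrtOneSub : PowerSeries.constantCoeff sqrtOneSub = 1 := by
  rw [← PowerSeries.coeff_zero_eq_constantCoeff_apply, sqrtOneSub, PowerSeries.coeff_rescale]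
  simp

theorem sqrtOneSub_eq : sqrtOneSub = 1 - 2 * scaledCatalan := by
  have h4 : (4 : PowerSeries ℝ) * PowerSeries.C (1 / 4) = 1 := by
    have : (4 : PowerSeries ℝ) = PowerSeries.C 4 := (map_ofNat PowerSeries.C 4).symm
    rw [this, ← map_mul]; norm_num
  have hsq : sqrtOneSub ^ 2 = (1 - 2 * scaledCatalan) ^ 2 := by
    rw [sqrtOneSub_sq]
    linear_combination 4 * scaledCatalan_eq + PowerSeries.X * h4
  rcases sq_eq_sq_iff_eq_or_eq_neg.1 hsq with h | h
  · exact h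
  · have h' := congrArg PowerSeries.constantCoeff h
    simp [constantCoeff_sqrtOneSub, constantCoeff_scaledCatalan] at h'
    norm_num at h'

/-- The series `q = 1/2 + v`, where `v` is `scaledCatalan`. -/
noncomputable def depthRatio : PowerSeries ℝ :=
  PowerSeries.C (1 / 2) + scaledCatalan

theorem two_mul_depthRatio : 2 * depthRatio = 2 - sqrtOneSub := by
  have h2 : (2 : PowerSeries ℝ) * PowerSeries.C (1 / 2) = 1 := by
    have : (2 : PowerSeries ℝ) = PowerSeries.C 2 := (map_ofNat PowerSeries.C 2).symm
    rw [this, ← map_mul]; norm_num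
  rw [depthRatio, sqrtOneSub_eq]
  linear_combination h2

/-- The coefficient of `x ^ r` is the Catalan ratio of `leafSeries r d * C ^ m`. -/
noncomputable def limitSeries (d m : ℕ) : PowerSeries ℝ :=
  PowerSeries.C (2 ^ m) * (PowerSeries.C (d / 4 : ℝ) * depthRatio ^ (d - 1) +
    PowerSeries.C (m / 2 : ℝ) * depthRatio ^ d)

theorem limitSeries_zero (m : ℕ) : limitSeries 0 m = PowerSeries.C (m / 2 * 2 ^ m : ℝ) := by
  simp [limitSeries, mul_comm]

theorem limitSeries_succ (d m : ℕ) :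
    limitSeries (d + 1) m =
      PowerSeries.C (1 / 4) * limitSeries d (m + 1) + scaledCatalan * limitSeries d m := by
  have hv : scaledCatalan = depthRatio - PowerSeries.C (1 / 2) := by simp [depthRatio]
  -- The truncated exponent `d - 1` at `d = 0` is harmless because of the factor `d`.
  have hd : PowerSeries.C (d / 4 : ℝ) * depthRatio ^ (d - 1) * depthRatio =
      PowerSeries.C (d / 4 : ℝ) * depthRatio ^ d := by
    rcases d with _ | d
    · simp
    · rw [Nat.add_sub_cancel, pow_succ, mul_assoc]
  have hc (a b c : ℝ) (h : a = b + c) :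
      (PowerSeries.C a : PowerSeries ℝ) = PowerSeries.C b + PowerSeries.C c := by rw [h, map_add]
  have e1 : (PowerSeries.C (((d + 1 : ℕ) : ℝ) / 4) : PowerSeries ℝ) =
      PowerSeries.C (d / 4 : ℝ) + PowerSeries.C (1 / 4) := hc _ _ _ (by push_cast; ring)
  have e2 : (PowerSeries.C (((m + 1 : ℕ) : ℝ) / 2) : PowerSeries ℝ) =
      PowerSeries.C (m / 2 : ℝ) + PowerSeries.C (1 / 2) := hc _ _ _ (by push_cast; ring)
  have e3 : (PowerSeries.C (1 / 4) : PowerSeries ℝ) * PowerSeries.C (2 ^ (m + 1)) =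
      PowerSeries.C (1 / 2) * PowerSeries.C (2 ^ m) := by
    rw [← map_mul, ← map_mul]; congr 1; ring
  have e4 : (PowerSeries.C (1 / 4) : PowerSeries ℝ) =
      PowerSeries.C (1 / 2) * PowerSeries.C (1 / 2) := by
    rw [← map_mul]; norm_num
  rw [limitSeries, limitSeries, limitSeries, e1, e2, hv, ← mul_assoc, e3, Nat.add_sub_cancel,
    e4]
  linear_combination (-PowerSeries.C (2 ^ m)) * hd

/-- The factor `C ^ m` makes the induction on `d` go through: when the marked leaf lies in the left
subtree, the right subtree is arbitrary and contributes one more factor `C`. -/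
theorem hasCatalanRatio_leafSeries_mul_pow (d : ℕ) : ∀ r m : ℕ,
    HasCatalanRatio (leafSeries r d * catalanSeriesReal ^ m)
      (PowerSeries.coeff r (limitSeries d m)) := by
  induction d with
  | zero =>
    intro r m
    rw [leafSeries_zero, limitSeries_zero, PowerSeries.coeff_C]
    split_ifs
    · simpa using hasCatalanRatio_catalanSeriesReal_pow m
    · simpa using HasCatalanRatio.zero
  | succ d ih =>
    intro r m
    have h : leafSeries r (d + 1) * catalanSeriesReal ^ m =
        PowerSeries.X * (leafSeries r d * catalanSeriesReal ^ (m + 1)) +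
          ∑ kl ∈ Finset.HasAntidiagonal.antidiagonal r,
            PowerSeries.C (PowerSeries.coeff kl.1 (PowerSeries.X * catalanSeriesReal)) *
              (PowerSeries.X ^ kl.1 * (leafSeries kl.2 d * catalanSeriesReal ^ m)) := by
      rw [leafSeries_succ, add_mul, Finset.sum_mul]
      congr 1
      · ring
      · exact Finset.sum_congr rfl fun _ _ => by ring
    rw [h, limitSeries_succ, map_add, PowerSeries.coeff_C_mul, PowerSeries.coeff_mul]
    refine HasCatalanRatio.add ?_ (HasCatalanRatio.sum fun kl _ => ?_)
    · convert (ih r (m + 1)).X_mul using 1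
      ring
    · convert ((ih kl.2 m).X_pow_mul kl.1).C_mul _ using 1
      rw [scaledCatalan, PowerSeries.coeff_rescale]
      ring

theorem tendsto_leafDepthProb (r d : ℕ) :
    Tendsto (fun n => leafDepthProb n r d) atTop
      (𝓝 (PowerSeries.coeff r (PowerSeries.C (d / 4 : ℝ) * depthRatio ^ (d - 1)))) := by
  have h := hasCatalanRatio_leafSeries_mul_pow d r 0
  have hl : limitSeries d 0 = PowerSeries.C (d / 4 : ℝ) * depthRatio ^ (d - 1) := by
    simp [limitSeries]
  rw [hl, pow_zero, mul_one] at h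
  refine Tendsto.congr (fun n => ?_) h
  rw [leafSeries, PowerSeries.coeff_mk, leafDepthProb, leafCount,
    BinaryTree.treesOfNumNodesEq_card_eq_catalan]

/-! ### Summation over the depth -/

/-- A truncated form of `∑ d u ^ (d - 1) = (1 - u) ^ (-2)`. -/
theorem sum_range_mul_one_sub_sq {R : Type*} [CommRing R] (y q : R) (N : ℕ) :
    (∑ d ∈ Finset.range N, (d + 1 : R) * q ^ d * y ^ (d + 1)) * (1 - y * q) ^ 2 =
      y + y ^ (N + 1) * ((N * (y * q) - (N + 1)) * q ^ N) := by
  induction N with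
  | zero => simp
  | succ N ih =>
    rw [Finset.sum_range_succ, add_mul, ih]
    push_cast
    ring

/-- The map taking a power series in one variable to the same series in the variable `x`. -/
noncomputable def inX : PowerSeries ℝ →ₐ[ℝ] MvPowerSeries (Fin 2) ℝ :=
  PowerSeries.substAlgHom (PowerSeries.HasSubst.X (0 : Fin 2))

theorem coeff_inX_mul_X_pow (f : PowerSeries ℝ) (d : ℕ) (e : Fin 2 →₀ ℕ) :
    MvPowerSeries.coeff e (inX f * MvPowerSeries.X 1 ^ d) =
      if e 1 = d then PowerSeries.coeff (e 0) f else 0 := by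
  rw [MvPowerSeries.X_pow_eq, MvPowerSeries.coeff_mul_monomial, inX, PowerSeries.coe_substAlgHom]
  have hle : Finsupp.single 1 d ≤ e ↔ d ≤ e 1 := Finsupp.single_le_iff
  have heq : e - Finsupp.single 1 d =
      Finsupp.single 0 ((e - Finsupp.single (1 : Fin 2) d) 0) ↔ e 1 - d = 0 := by
    rw [Finsupp.ext_iff, Fin.forall_fin_two]
    simp
  rw [PowerSeries.coeff_subst_single]
  simp only [hle, heq, mul_one]
  by_cases h : e 1 = d
  · simp [h]
  · by_cases h1 : d ≤ e 1
    · rw [if_pos h1, if_neg (by omega), if_neg h]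
    · rw [if_neg h1, if_neg h]

theorem coeff_mul_X_one_pow_of_lt (f : MvPowerSeries (Fin 2) ℝ) {N : ℕ} {e : Fin 2 →₀ ℕ}
    (h : e 1 < N) : MvPowerSeries.coeff e (MvPowerSeries.X 1 ^ N * f) = 0 := by
  rw [MvPowerSeries.X_pow_eq, MvPowerSeries.coeff_monomial_mul, if_neg]
  rw [Finsupp.single_le_iff]
  omega

/-- The summation over `d` in closed form: `4 * ∑ d/4 q^(d-1) y^d = y / (1 - y q)²`. -/
theorem depthSeries_eq (q : PowerSeries ℝ) :
    depthSeries (fun r d => PowerSeries.coeff r (PowerSeries.C (d / 4 : ℝ) * q ^ (d - 1))) =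
      MvPowerSeries.C (1 / 4) * (MvPowerSeries.X 1 * ((1 - MvPowerSeries.X 1 * inX q) ^ 2)⁻¹) := by
  have hunit : MvPowerSeries.constantCoeff
      ((1 - MvPowerSeries.X 1 * inX q) ^ 2 : MvPowerSeries (Fin 2) ℝ) ≠ 0 := by
    simp
  ext e
  -- Truncating the sum after the exponent of `y` in `e` does not affect the coefficient at `e`.
  set N := e 1 with hN
  have h := sum_range_mul_one_sub_sq (MvPowerSeries.X 1 : MvPowerSeries (Fin 2) ℝ) (inX q) N
  have h' := congrArg (· * ((1 - MvPowerSeries.X 1 * inX q) ^ 2 : MvPowerSeries (Fin 2) ℝ)⁻¹) h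
  rw [mul_assoc, MvPowerSeries.mul_inv_cancel _ hunit, mul_one, add_mul, mul_assoc (_ ^ (N + 1))]
    at h'
  rw [← sub_eq_iff_eq_add] at h'
  rw [← h', MvPowerSeries.coeff_C_mul, map_sub, coeff_mul_X_one_pow_of_lt _ (by omega), sub_zero,
    map_sum]
  have hterm (d : ℕ) : MvPowerSeries.coeff e
      (((d : MvPowerSeries (Fin 2) ℝ) + 1) * inX q ^ d * MvPowerSeries.X 1 ^ (d + 1)) =
        if N = d + 1 then ((d : ℝ) + 1) * PowerSeries.coeff (e 0) (q ^ d) else 0 := by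
    have hc : (d : MvPowerSeries (Fin 2) ℝ) + 1 = MvPowerSeries.C ((d : ℝ) + 1) := by simp
    rw [hc, mul_assoc, MvPowerSeries.coeff_C_mul, ← map_pow, coeff_inX_mul_X_pow, mul_ite, mul_zero]
  simp only [hterm]
  change (if 1 ≤ e 1 then _ else _) = _
  rw [← hN]
  rcases N with _ | M
  · simp
  · rw [Finset.sum_eq_single M (fun d _ hd => if_neg (by omega)) (by simp)]
    simp only [if_true, PowerSeries.coeff_C_mul, Nat.add_sub_cancel]
    rw [if_pos (by omega)]
    push_cast
    ring

theorem mainTheorem1 :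
    ∃ p : ℕ → ℕ → ℝ,
      (∀ r d : ℕ, 1 ≤ d → Tendsto (fun n : ℕ => leafDepthProb n r d) atTop (𝓝 (p r d))) ∧
      depthSeries p =
        MvPowerSeries.X 1 *
          ((2 - 2 * MvPowerSeries.X 1 + MvPowerSeries.X 1 * sqrtOneSubX) ^ 2)⁻¹ := by
  refine ⟨_, fun r d _ => tendsto_leafDepthProb r d, ?_⟩
  have hq : 2 * inX depthRatio = 2 - sqrtOneSubX := by
    have h := congrArg inX two_mul_depthRatio
    simp only [map_mul, map_sub, map_ofNat] at h
    rw [h, inX, PowerSeries.coe_substAlgHom, sqrtOneSubX]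
  have hfac : (2 - 2 * MvPowerSeries.X 1 + MvPowerSeries.X 1 * sqrtOneSubX :
      MvPowerSeries (Fin 2) ℝ) = MvPowerSeries.C 2 * (1 - MvPowerSeries.X 1 * inX depthRatio) := by
    have h2 : (MvPowerSeries.C 2 : MvPowerSeries (Fin 2) ℝ) = 2 := map_ofNat MvPowerSeries.C 2
    rw [h2]
    linear_combination MvPowerSeries.X 1 * hq
  rw [depthSeries_eq, hfac, mul_pow, MvPowerSeries.mul_inv_rev, ← map_pow, MvPowerSeries.C_inv]
  norm_num
  ring
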